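/- Let $n\ge 1$. For each $i=1,\dots,n$ let $X_i=\prod_{s\in S_i}X_{i,s}$ be the topological product of an arbitrary family of separable metrizable spaces $X_{i,s}$, let $X=X_1\times\cdots\times X_n$, and let $E\subseteq X$. Then the following are equivalent: (a) there is a separately continuous function $f:X_1\times\cdots\times X_n\to\mathbb R$ (that is, $f$ is continuous in each variable $x_i\in X_i$ when the other variables are fixed) whose set of discontinuity points is exactly $E$; (b) there exist at most countable sets $T_i\subseteq S_i$ ($i=1,\dots,n$) and a projectively meagre $F_\sigma$-set $E_0$ in $Y=Y_1\times\cdots\times Y_n$, where $Y_i=\prod_{s\in T_i}X_{i,s}$, such that $E=\mathrm{pr}^{-1}(E_0)$, where $\mathrm{pr}:X\to Y$ is the natural projection $\mathrm{pr}(x_1,\dots,x_n)=(x_1|_{T_1},\dots,x_n|_{T_n})$. Here a subset $A$ of a product $Z_1\times\cdots\times Z_n$ of topological spaces is called projectively meagre if for every $i=1,\dots,n$ the image of $A$ under the projection $(z_1,\dots,z_n)\mapsto(z_1,\dots,z_{i-1},z_{i+1},\dots,z_n)$ is meagre (of first category) in $Z_1\times\cdots\times Z_{i-1}\times Z_{i+1}\times\cdots\times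 Z_n$ (a one-point space if $n=1$), and an $F_\sigma$-set is a countable union of closed sets. -/

import Mathlib

/-- A function of the variables `x i` (`i : ι`) is separately continuous if it is continuous
in each variable when all the other variables are kept fixed. -/
def SeparatelyContinuous {ι : Type*} [DecidableEq ι] {X : ι → Type*}
    [∀ i, TopologicalSpace (X i)] {Z : Type*} [TopologicalSpace Z]
    (f : (∀ i, X i) → Z) : Prop :=
  ∀ (i : ι) (x : ∀ j, X j), Continuous fun t : X i => f (Function.update x i t)

/-- The set of discontinuity points of a function. -/
def discontinuityPoints {X Z : Type*} [TopologicalSpace X] [TopologicalSpace Z]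
    (f : X → Z) : Set X :=
  {x | ¬ ContinuousAt f x}

/-- The projection of a product parallel to the `i`-th factor, i.e. onto the product of
all the other factors. -/
def projParallel {ι : Type*} {X : ι → Type*} (i : ι) (x : ∀ j, X j) :
    ∀ j : {j : ι // j ≠ i}, X j :=
  fun j => x j

/-- A subset of a product is projectively meagre if, for every `i`, its projection parallel to
the `i`-th factor is meagre in the product of the other factors. -/
def ProjectivelyMeagre {ι : Type*} {X : ι → Type*} [∀ i, TopologicalSpace (X i)]
    (E : Set (∀ i, X i)) : Prop :=
  ∀ i : ι, IsMeagre (projParallel i '' E)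

/-- An `F_σ` set: the union of a sequence of closed sets. -/
def IsFSigma {X : Type*} [TopologicalSpace X] (E : Set X) : Prop :=
  ∃ F : ℕ → Set X, (∀ k, IsClosed (F k)) ∧ E = ⋃ k, F k

/-- The natural projection `(x₁, …, xₙ) ↦ (x₁|T₁, …, xₙ|Tₙ)`. -/
def restrictProj {ι : Type*} {S : ι → Type*} {X : ∀ i, S i → Type*}
    (T : ∀ i, Set (S i)) (x : ∀ i, ∀ s : S i, X i s) : ∀ i, ∀ s : T i, X i s :=
  fun i s => x i s

/-! From (a) to (b), the first point is that `f` depends on countably many coordinates. If not,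
caliber `ℵ₁` of products of separable spaces, applied one variable at a time, yields a single point
at which uncountably many one-coordinate changes alter `f`, uncountably many of them by more than a
fixed amount. Continuity in one variable for the product topology allows only finitely many such
changes. So `f` factors through second countable products. There its discontinuity set is `F_σ`, and
it is projectively meagre by a category argument (`isMeagre_setOf_exists_not_continuousAt`) with
induction on the number of variables. The factors need not be Baire, so the argument stays near
points without meagre neighbourhoods; the remaining points are negligible.

From (b) to (a), `E₀` is cut into closed sets `F k` lying in cylinders over closed nowhere dense
sets. A quotient of distances gives `u k`, discontinuous exactly on `F k` and zero on these
cylinders, hence on every axis-parallel line through `F k`; this makes `u k` separately continuous.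
In the sum, the weights `4⁻ᵏ` keep the jumps from cancelling. Since `pr` has continuous sections,
composing with it pulls discontinuity sets back exactly. -/

open Set Filter Topology TopologicalSpace

universe u v

/-! ### Caliber `ℵ₁` of products of separable spaces. -/

section Caliber

/-- In a product of separable spaces indexed by a set of coordinates that is coded by binary
sequences on `B`, countably many points meet every basic open set supported in `B`. -/
theorem exists_countable_family_meeting_boxes {S : Type*} {X : S → Type*}
    [∀ s, TopologicalSpace (X s)] [∀ s, SeparableSpace (X s)] [∀ s, Nonempty (X s)]
    {B : Set S} {e : S → ℕ → Bool} (he : InjOn e B) :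
    ∃ d : (Σ k : ℕ, ((Fin k → Bool) → ℕ)) → ∀ s, X s,
      ∀ (F : Finset S) (u : ∀ s, Set (X s)), (↑F ⊆ B) →
        (∀ s ∈ F, IsOpen (u s) ∧ (u s).Nonempty) → ∃ p, ∀ s ∈ F, d p s ∈ u s := by
  classical
  -- The first `k` bits of the code of a coordinate select, through the table `p.2`, an index into
  -- its dense sequence. There are only countably many tables.
  refine ⟨fun p s => denseSeq (X s) (p.2 fun i => e s i), fun F u hF hu => ?_⟩
  have hn : ∀ s, ∃ m, s ∈ F → denseSeq (X s) m ∈ u s := fun s => by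
    by_cases hs : s ∈ F
    · obtain ⟨m, hm⟩ := (denseRange_denseSeq (X s)).exists_mem_open (hu s hs).1 (hu s hs).2
      exact ⟨m, fun _ => hm⟩
    · exact ⟨0, fun h => (hs h).elim⟩
  choose m hm using hn
  have hdiff : ∀ q : S × S, ∃ l, q.1 ∈ F → q.2 ∈ F → q.1 ≠ q.2 → e q.1 l ≠ e q.2 l := by
    rintro ⟨s, t⟩
    by_cases h : s ∈ F ∧ t ∈ F ∧ s ≠ t
    · obtain ⟨l, hl⟩ := Function.ne_iff.1 (mt (fun h' => he (hF h.1) (hF h.2.1) h') h.2.2)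
      exact ⟨l, fun _ _ _ => hl⟩
    · exact ⟨0, fun h1 h2 h3 => (h ⟨h1, h2, h3⟩).elim⟩
  choose l hl using hdiff
  -- Enough bits to separate any two coordinates of `F`, so the table can be prescribed
  -- independently on them.
  set k := (F ×ˢ F).sup l + 1
  have hinj : InjOn (fun (s : S) (i : Fin k) => e s i) F := by
    intro s hs t ht hst
    by_contra hne
    have hlt : l (s, t) < k :=
      Nat.lt_succ_of_le (Finset.le_sup (f := l) (Finset.mem_product.2 ⟨hs, ht⟩))
    exact hl (s, t) hs ht hne (congrFun hst ⟨l (s, t), hlt⟩)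
  refine ⟨⟨k, fun w => if h : ∃ s ∈ F, (fun i : Fin k => e s i) = w then m h.choose else 0⟩,
    fun s hs => ?_⟩
  have hex : ∃ t ∈ F, (fun i : Fin k => e t i) = fun i : Fin k => e s i := ⟨s, hs, rfl⟩
  have : hex.choose = s := hinj hex.choose_spec.1 hs hex.choose_spec.2
  simp only [dif_pos hex]
  rw [this]
  exact hm s hs

/-- Products of separable spaces have caliber `ℵ₁`. -/
theorem exists_not_countable_setOf_mem_of_isOpen_pi {α S : Type u} {X : S → Type*}
    [∀ s, TopologicalSpace (X s)] [∀ s, SeparableSpace (X s)]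
    {A : Set α} (hA : ¬ A.Countable) (U : α → Set (∀ s, X s))
    (hU : ∀ a ∈ A, IsOpen (U a)) (hne : ∀ a ∈ A, (U a).Nonempty) :
    ∃ x, ¬ {a ∈ A | x ∈ U a}.Countable := by
  classical
  have hA1 : Cardinal.aleph 1 ≤ Cardinal.mk A := by
    rw [← Cardinal.succ_aleph0, Order.succ_le_iff, ← not_le]
    rwa [Cardinal.le_aleph0_iff_set_countable]
  -- With exactly `ℵ₁` sets kept, the supports of boxes inside them cover at most `ℵ₁ ≤ 𝔠`
  -- coordinates, which binary sequences can code.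
  obtain ⟨A', hA', hcard⟩ := Cardinal.le_mk_iff_exists_subset.1 hA1
  have hA'c : ¬ A'.Countable := by
    rw [← Cardinal.le_aleph0_iff_set_countable, hcard, not_le]
    exact Cardinal.aleph0_lt_aleph_one
  have hA'ne : A'.Nonempty := nonempty_iff_ne_empty.2 fun h => hA'c (h ▸ countable_empty)
  obtain ⟨a₀, ha₀⟩ := hA'ne
  obtain ⟨x₀, -⟩ := hne a₀ (hA' ha₀)
  have : ∀ s, Nonempty (X s) := fun s => ⟨x₀ s⟩
  have hbox : ∀ a : α, ∃ (F : Finset S) (u : ∀ s, Set (X s)), a ∈ A' →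
      (∀ s ∈ F, IsOpen (u s) ∧ (u s).Nonempty) ∧ (F : Set S).pi u ⊆ U a := by
    intro a
    by_cases ha : a ∈ A'
    · obtain ⟨x, hx⟩ := hne a (hA' ha)
      obtain ⟨F, u, hu, hsub⟩ := isOpen_pi_iff.1 (hU a (hA' ha)) x hx
      exact ⟨F, u, fun _ => ⟨fun s hs => ⟨(hu s hs).1, _, (hu s hs).2⟩, hsub⟩⟩
    · exact ⟨∅, fun _ => univ, fun h => (ha h).elim⟩
  choose F u hFu using hbox
  set B : Set S := ⋃ a : A', (F a : Set S)
  have hB : Cardinal.lift.{0} (Cardinal.mk B) ≤ Cardinal.lift.{u} (Cardinal.mk (ℕ → Bool)) := by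
    have h1 : Cardinal.mk B ≤ Cardinal.aleph 1 * Cardinal.aleph0 := by
      refine (Cardinal.mk_iUnion_le _).trans (mul_le_mul' hcard.le (ciSup_le' fun a => ?_))
      exact Cardinal.le_aleph0_iff_set_countable.2 (Finset.countable_toSet _)
    rw [Cardinal.mul_eq_left Cardinal.aleph0_lt_aleph_one.le Cardinal.aleph0_lt_aleph_one.le
      Cardinal.aleph0_ne_zero] at h1
    simpa using h1.trans Cardinal.aleph_one_le_continuum
  obtain ⟨g⟩ := Cardinal.lift_mk_le'.1 hB
  obtain ⟨d, hd⟩ := exists_countable_family_meeting_boxes (X := X) (B := B)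
    (e := fun s => if h : s ∈ B then g ⟨s, h⟩ else default) (by
      intro s hs t ht hst
      simp only [dif_pos hs, dif_pos ht] at hst
      exact congrArg Subtype.val (g.injective hst))
  by_contra! hcon
  refine hA'c (Countable.mono (s₂ := ⋃ p, {a ∈ A | d p ∈ U a}) (fun a ha => ?_)
    (countable_iUnion fun p => hcon (d p)))
  obtain ⟨p, hp⟩ := hd (F a) (u a) (subset_iUnion (fun a : A' => (F a : Set S)) ⟨a, ha⟩)
    (hFu a ha).1
  exact mem_iUnion.2 ⟨p, hA' ha, (hFu a ha).2 hp⟩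

end Caliber

/-! ### Dependence on countably many coordinates. -/

section Dependence

variable {ι : Type*} [Fintype ι] [DecidableEq ι]

/-- The variables are frozen one at a time: caliber `ℵ₁` gives a common value of the `j`-th variable
keeping uncountably many `h a` nonzero at their witnesses `p a`. Once all variables are frozen, the
witnesses coincide. -/
theorem exists_not_countable_setOf_ne_zero {α : Type u} {S : ι → Type u} {X : ∀ i, S i → Type*}
    [∀ i s, TopologicalSpace (X i s)] [∀ i s, SeparableSpace (X i s)]
    {A : Set α} (hA : ¬ A.Countable) {h : α → (∀ i s, X i s) → ℝ}
    (hh : ∀ a ∈ A, SeparatelyContinuous (h a)) (hne : ∀ a ∈ A, ∃ x, h a x ≠ 0) :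
    ∃ x, ¬ {a ∈ A | h a x ≠ 0}.Countable := by
  classical
  have key : ∀ J : Finset ι, ∃ A' ⊆ A, ¬ A'.Countable ∧ ∃ (x : ∀ i s, X i s)
      (p : α → ∀ i s, X i s), ∀ a ∈ A', h a (p a) ≠ 0 ∧ ∀ j ∈ J, p a j = x j := by
    intro J
    induction J using Finset.induction_on with
    | empty =>
      have hne' : A.Nonempty := nonempty_iff_ne_empty.2 fun h => hA (h ▸ countable_empty)
      obtain ⟨a₀, ha₀⟩ := hne'
      obtain ⟨x₀, -⟩ := hne a₀ ha₀
      have : ∀ a, ∃ x, a ∈ A → h a x ≠ 0 := fun a => by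
        by_cases ha : a ∈ A
        · exact (hne a ha).imp fun _ h _ => h
        · exact ⟨x₀, fun h => (ha h).elim⟩
      choose p hp using this
      exact ⟨A, Subset.rfl, hA, x₀, p, fun a ha => ⟨hp a ha, by simp⟩⟩
    | insert j J hj ih =>
      obtain ⟨A', hA', hc, x, p, hp⟩ := ih
      obtain ⟨t, ht⟩ := exists_not_countable_setOf_mem_of_isOpen_pi hc
        (fun a => {t : ∀ s, X j s | h a (Function.update (p a) j t) ≠ 0})
        (fun a ha => isOpen_ne.preimage (hh a (hA' ha) j (p a)))
        (fun a ha => ⟨p a j, by simpa using (hp a ha).1⟩)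
      refine ⟨{a ∈ A' | t ∈ {t : ∀ s, X j s | h a (Function.update (p a) j t) ≠ 0}},
        (sep_subset _ _).trans hA', ht, Function.update x j t,
        fun a => Function.update (p a) j t, fun a ha => ⟨ha.2, fun i hi => ?_⟩⟩
      rcases eq_or_ne i j with rfl | hij
      · simp
      · simpa [hij] using (hp a ha.1).2 i (Finset.mem_of_mem_insert_of_ne hi hij)
  obtain ⟨A', hA', hc, x, p, hp⟩ := key Finset.univ
  refine ⟨x, fun hcount => hc (hcount.mono fun a ha => ?_)⟩
  refine mem_sep (hA' ha) ?_
  have : p a = x := funext fun j => (hp a ha).2 j (Finset.mem_univ j)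
  exact this ▸ (hp a ha).1

/-- The coordinates `s` of the `i`-th variable on which `f` depends. -/
def essentialCoords {S : ι → Type*} {X : ∀ i, S i → Type*} (f : (∀ i s, X i s) → ℝ) (i : ι) :
    Set (S i) :=
  open Classical in
  {s | ∃ (x : ∀ i s, X i s) (a : X i s),
    f (Function.update x i (Function.update (x i) s a)) ≠ f x}

theorem SeparatelyContinuous.countable_essentialCoords {S : ι → Type u} {X : ∀ i, S i → Type*}
    [∀ i s, TopologicalSpace (X i s)] [∀ i s, SeparableSpace (X i s)]
    {f : (∀ i s, X i s) → ℝ} (hf : SeparatelyContinuous f) (i : ι) :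
    (essentialCoords f i).Countable := by
  classical
  by_contra hA
  have hch : ∀ s : S i, ∃ h : (∀ i s, X i s) → ℝ, s ∈ essentialCoords f i →
      SeparatelyContinuous h ∧ (∃ x, h x ≠ 0) ∧ ∃ a : X i s, ∀ x,
        h x = f (Function.update x i (Function.update (x i) s a)) - f x := by
    intro s
    by_cases hs : s ∈ essentialCoords f i
    · obtain ⟨x, a, hxa⟩ := hs
      refine ⟨fun x => f (Function.update x i (Function.update (x i) s a)) - f x,
        fun _ => ⟨fun j y => ?_, ⟨x, sub_ne_zero.2 (by convert hxa)⟩, a, fun _ => rfl⟩⟩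
      refine Continuous.sub ?_ (hf j y)
      rcases eq_or_ne j i with rfl | hji
      · simp only [Function.update_idem, Function.update_self]
        exact (hf j y).comp (by fun_prop)
      · have : ∀ t, Function.update (Function.update y j t) i
            (Function.update (Function.update y j t i) s a) =
            Function.update (Function.update y i (Function.update (y i) s a)) j t := by
          intro t
          rw [Function.update_of_ne hji.symm, Function.update_comm hji]
        simp only [this]
        exact hf j _
    · exact ⟨0, fun h => (hs h).elim⟩
  choose h hh using hch
  obtain ⟨x, hx⟩ := exists_not_countable_setOf_ne_zero hA (fun s hs => (hh s hs).1)
    (fun s hs => (hh s hs).2.1)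
  have hex : ∃ k : ℕ, ¬ {s ∈ essentialCoords f i | 1 / ((k : ℝ) + 1) < |h s x|}.Countable := by
    by_contra! hcon
    refine hx ((countable_iUnion hcon).mono fun s hs => ?_)
    obtain ⟨k, hk⟩ := exists_nat_one_div_lt (abs_pos.2 hs.2)
    exact mem_iUnion.2 ⟨k, hs.1, hk⟩
  obtain ⟨k, hk⟩ := hex
  have hcont := (hf i x).continuousAt (x := x i)
  have hnhds := hcont.eventually (Metric.ball_mem_nhds _ (Nat.one_div_pos_of_nat (n := k)))
  rw [nhds_pi, Filter.Eventually, Filter.mem_pi] at hnhds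
  obtain ⟨I, hI, t, ht, hsub⟩ := hnhds
  -- Changing a coordinate outside the finite set `I` stays in the neighbourhood, so it moves `f` by
  -- less than `1 / (k + 1)`.
  refine hk (hI.countable.mono fun s hs => ?_)
  by_contra hsI
  obtain ⟨a, ha⟩ := (hh s hs.1).2.2
  have hmem : Function.update (x i) s a ∈ I.pi t := fun r hr => by
    have : r ≠ s := fun h => hsI (h ▸ hr)
    simpa [this] using mem_of_mem_nhds (ht r)
  have := hsub hmem
  simp only [mem_ofPred_eq, Real.dist_eq, Function.update_eq_self] at this
  have h2 := hs.2
  rw [ha] at h2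
  exact lt_asymm this h2

/-- A separately continuous function is determined by its essential coordinates. -/
theorem SeparatelyContinuous.eq_of_eqOn_essentialCoords {S : ι → Type*} {X : ∀ i, S i → Type*}
    [∀ i s, TopologicalSpace (X i s)] {f : (∀ i s, X i s) → ℝ} (hf : SeparatelyContinuous f)
    {x y : ∀ i s, X i s} (hxy : ∀ i, ∀ s ∈ essentialCoords f i, x i s = y i s) : f x = f y := by
  classical
  have step : ∀ (i : ι) (z : ∀ i s, X i s) (t : ∀ s, X i s),
      (∀ s ∈ essentialCoords f i, t s = z i s) → f (Function.update z i t) = f z := by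
    intro i z t ht
    have fin : ∀ F : Finset (S i),
        f (Function.update z i (fun s => if s ∈ F then t s else z i s)) = f z := by
      intro F
      induction F using Finset.induction_on with
      | empty => simp [Function.update_eq_self]
      | insert s F hs ih =>
        rw [← ih]
        by_cases hse : s ∈ essentialCoords f i
        · congr 2
          ext r
          rcases eq_or_ne r s with rfl | hrs
          · simp [ht r hse]
          · simp [hrs]
        · by_contra hne
          refine hse ⟨_, t s, fun h => hne (Eq.trans ?_ h)⟩
          congr 1
          rw [Function.update_idem, Function.update_self]
          congr 1
          ext r
          rcases eq_or_ne r s with rfl | hrs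
          · simp
          · simp [hrs]
    -- Finite modifications converge to `t` in the product topology, so continuity in the `i`-th
    -- variable extends `fin` to infinitely many changes.
    have hlim : Tendsto (fun F : Finset (S i) => fun s => if s ∈ F then t s else z i s) atTop
        (𝓝 t) := by
      refine tendsto_pi_nhds.2 fun s => tendsto_const_nhds.congr' ?_
      filter_upwards [eventually_ge_atTop {s}] with F hF
      rw [if_pos (hF (Finset.mem_singleton_self s))]
    have h1 := ((hf i z).tendsto t).comp hlim
    refine tendsto_nhds_unique h1 (tendsto_const_nhds.congr fun F => (fin F).symm)
  have all : ∀ J : Finset ι, f (fun j => if j ∈ J then x j else y j) = f y := by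
    intro J
    induction J using Finset.induction_on with
    | empty => simp
    | insert i J hi ih =>
      rw [← ih, ← step i (fun j => if j ∈ J then x j else y j) (x i)
        (fun s hs => by simpa [hi] using hxy i s hs)]
      congr 1
      ext j : 1
      rcases eq_or_ne j i with rfl | hji
      · simp
      · simp [hji]
  simpa using all Finset.univ

end Dependence

/-! ### Functions with a prescribed closed discontinuity set. -/

section SingleSet

/-- A nowhere dense closed set `L` of a separable metric space can be avoided by a set `P` whose
accumulation points form a prescribed closed subset `E` of `L`. -/
theorem exists_disjoint_closure_subset_union {M : Type*} [MetricSpace M] [SeparableSpace M]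
    {E L : Set M} (hE : IsClosed E) (hL : Dense Lᶜ) :
    ∃ P : Set M, Disjoint P L ∧ E ⊆ closure P ∧ closure P ⊆ P ∪ E := by
  rcases E.eq_empty_or_nonempty with rfl | hne
  · exact ⟨∅, by simp⟩
  have : Nonempty E := hne.to_subtype
  have : SecondCountableTopology M := UniformSpace.secondCountable_of_separable M
  -- Unpairing repeats each term of the dense sequence infinitely often, hence with arbitrarily
  -- small error `1 / (m + 1)`.
  let e : ℕ → E := fun m => denseSeq E m.unpair.1
  have hp : ∀ m : ℕ, ∃ p, p ∉ L ∧ dist p (e m) < 1 / ((m : ℝ) + 1) := fun m => by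
    obtain ⟨p, hp, hd⟩ := hL.exists_mem_open Metric.isOpen_ball
      ⟨(e m : M), Metric.mem_ball_self (Nat.one_div_pos_of_nat (n := m))⟩
    exact ⟨p, hp, hd⟩
  choose p hpL hpe using hp
  refine ⟨range p, ?_, ?_, ?_⟩
  · rw [disjoint_left]
    rintro _ ⟨m, rfl⟩
    exact hpL m
  · intro x hx
    rw [Metric.mem_closure_iff]
    intro ε hε
    obtain ⟨k, hk⟩ := (denseRange_denseSeq E).exists_dist_lt (⟨x, hx⟩ : E) (half_pos hε)
    obtain ⟨l, hl⟩ := exists_nat_one_div_lt (half_pos hε)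
    refine ⟨_, mem_range_self (Nat.pair k l), ?_⟩
    have h1 := hpe (Nat.pair k l)
    have h2 : (e (Nat.pair k l) : M) = denseSeq E k := by simp [e]
    have h3 : 1 / ((Nat.pair k l : ℕ) + 1 : ℝ) ≤ 1 / ((l : ℝ) + 1) := by
      have : (l : ℝ) ≤ (Nat.pair k l : ℕ) := by exact_mod_cast Nat.right_le_pair k l
      gcongr
    rw [h2, dist_comm] at h1
    have h4 : dist x (denseSeq E k : M) < ε / 2 := hk
    linarith [dist_triangle x (denseSeq E k : M) (p (Nat.pair k l))]
  · intro x hx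
    by_contra hxn
    rw [mem_union, not_or] at hxn
    obtain ⟨ε, hε, hball⟩ := Metric.isOpen_iff.1 hE.isOpen_compl x hxn.2
    obtain ⟨l, hl⟩ := exists_nat_one_div_lt (half_pos hε)
    -- Since `p m` with `m ≥ l` is within `ε / 2` of `E`, only finitely many `p m` can come within
    -- `ε / 2` of `x`.
    have hxcl : x ∈ closure (p '' (Finset.range l : Set ℕ)) := by
      rw [Metric.mem_closure_iff] at hx ⊢
      intro δ hδ
      obtain ⟨_, ⟨m, rfl⟩, hm⟩ := hx (min δ (ε / 2)) (lt_min hδ (half_pos hε))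
      refine ⟨p m, ⟨m, ?_, rfl⟩, hm.trans_le (min_le_left _ _)⟩
      by_contra hml
      have hml : l ≤ m := by simpa using hml
      have h1 := hpe m
      have h3 : 1 / ((m : ℝ) + 1) ≤ 1 / ((l : ℝ) + 1) := by gcongr
      have h4 : (e m : M) ∈ Metric.ball x ε := by
        rw [Metric.mem_ball, dist_comm]
        linarith [dist_triangle x (p m) (e m), hm.trans_le (min_le_right _ _)]
      exact hball h4 (e m).2
    rw [((Finset.finite_toSet _).image p).isClosed.closure_eq] at hxcl
    exact hxn.1 (image_subset_range _ _ hxcl)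

/-- Given a closed subset `E` of a closed nowhere dense set `L`, there is a function vanishing on
`L`, continuous off `E`, and taking the value `1` arbitrarily close to every point of `E`. -/
theorem exists_vanishing_continuousAt_off {M : Type*} [MetricSpace M] [SeparableSpace M]
    {E L : Set M} (hE : IsClosed E) (hLc : IsClosed L) (hL : Dense Lᶜ) (hEL : E ⊆ L) :
    ∃ f : M → ℝ, (∀ x, 0 ≤ f x ∧ f x ≤ 1) ∧ (∀ x ∈ L, f x = 0) ∧ (∀ x ∉ E, ContinuousAt f x) ∧
      ∀ x ∈ E, ∃ᶠ p in 𝓝 x, f p = 1 := by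
  rcases E.eq_empty_or_nonempty with rfl | hne
  · exact ⟨fun _ => 0, by simp [continuousAt_const]⟩
  obtain ⟨P, hPL, hEP, hPE⟩ := exists_disjoint_closure_subset_union hE hL
  have hLne : L.Nonempty := hne.mono hEL
  have hPne : P.Nonempty := closure_nonempty_iff.1 (hne.mono hEP)
  have h0 : ∀ x ∈ L, Metric.infDist x L = 0 := fun x hx => Metric.infDist_zero_of_mem hx
  -- The denominator vanishes only on `L ∩ closure P ⊆ E`, where division by zero gives the desired
  -- value `0`.
  refine ⟨fun x => Metric.infDist x L / (Metric.infDist x L + Metric.infDist x P),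
    fun x => ⟨?_, ?_⟩, fun x hx => by simp [h0 x hx], fun x hx => ?_, fun x hx => ?_⟩
  · have := Metric.infDist_nonneg (x := x) (s := L)
    have := Metric.infDist_nonneg (x := x) (s := P)
    positivity
  · have := Metric.infDist_nonneg (x := x) (s := L)
    have := Metric.infDist_nonneg (x := x) (s := P)
    exact div_le_one_of_le₀ (by linarith) (by linarith)
  · refine ((Metric.continuous_infDist_pt L).continuousAt).div
      ((Metric.continuous_infDist_pt L).add (Metric.continuous_infDist_pt P)).continuousAt ?_
    have h1 := Metric.infDist_nonneg (x := x) (s := L)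
    have h2 := Metric.infDist_nonneg (x := x) (s := P)
    intro hsum
    have h3 : Metric.infDist x L = 0 := by linarith
    have h4 : Metric.infDist x P = 0 := by linarith
    rw [← hLc.mem_iff_infDist_zero hLne] at h3
    rw [← Metric.mem_closure_iff_infDist_zero hPne] at h4
    rcases hPE h4 with h | h
    · exact disjoint_left.1 hPL h h3
    · exact hx h
  · refine (mem_closure_iff_frequently.1 (hEP hx)).mono fun p hp => ?_
    have hpos : Metric.infDist p L ≠ 0 := fun h =>
      disjoint_left.1 hPL hp ((hLc.mem_iff_infDist_zero hLne).2 h)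
    simp only [Metric.infDist_zero_of_mem hp, add_zero]
    exact div_self hpos

end SingleSet

/-! ### Summation without cancellation of jumps. -/

section Series

/-- Continuity at a point, relative to any approach, of the geometrically weighted sum of a
sequence of functions with values in `[0, 1]`. -/
theorem tendsto_tsum_geometric_mul {β : Type*} {l : Filter β} {u : ℕ → β → ℝ} {a : ℕ → ℝ}
    (hu : ∀ k b, 0 ≤ u k b ∧ u k b ≤ 1) (h : ∀ k, Tendsto (u k) l (𝓝 (a k))) :
    Tendsto (fun b => ∑' k, (1 / 4 : ℝ) ^ k * u k b) l (𝓝 (∑' k, (1 / 4 : ℝ) ^ k * a k)) := by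
  refine tendsto_tsum_of_dominated_convergence (bound := fun k => (1 / 4 : ℝ) ^ k)
    (summable_geometric_of_lt_one (by norm_num) (by norm_num)) (fun k => (h k).const_mul _)
    (Eventually.of_forall fun b k => ?_)
  rw [Real.norm_of_nonneg (mul_nonneg (by positivity) (hu k b).1)]
  exact mul_le_of_le_one_right (by positivity) (hu k b).2

theorem summable_geometric_mul {a : ℕ → ℝ} (ha : ∀ k, 0 ≤ a k ∧ a k ≤ 1) :
    Summable fun k => (1 / 4 : ℝ) ^ k * a k :=
  Summable.of_nonneg_of_le (fun k => mul_nonneg (by positivity) (ha k).1)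
    (fun k => mul_le_of_le_one_right (by positivity) (ha k).2)
    (summable_geometric_of_lt_one (by norm_num) (by norm_num))

/-- At the least `k` with `x ∈ E k` the earlier terms are continuous. The terms after `k` total at
most `4⁻ᵏ / 3`, too little to mask the jump `4⁻ᵏ` of the `k`-th term. -/
theorem discontinuityPoints_tsum_geometric_mul {M : Type*} [TopologicalSpace M] {u : ℕ → M → ℝ}
    {E : ℕ → Set M} (hu : ∀ k x, 0 ≤ u k x ∧ u k x ≤ 1) (h0 : ∀ k, ∀ x ∈ E k, u k x = 0)
    (hc : ∀ k, ∀ x ∉ E k, ContinuousAt (u k) x) (h1 : ∀ k, ∀ x ∈ E k, ∃ᶠ p in 𝓝 x, u k p = 1) :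
    discontinuityPoints (fun x => ∑' k, (1 / 4 : ℝ) ^ k * u k x) = ⋃ k, E k := by
  ext x
  rw [mem_iUnion]
  constructor
  · intro hx
    by_contra! hcon
    exact hx (tendsto_tsum_geometric_mul hu fun k => hc k x (hcon k))
  · intro hx hcont
    classical
    set k := Nat.find hx
    have hk : x ∈ E k := Nat.find_spec hx
    have hhead : ContinuousAt (fun y => ∑ j ∈ Finset.range k, (1 / 4 : ℝ) ^ j * u j y) x := by
      refine tendsto_finsetSum _ fun j hj => ?_
      exact (hc j x (Nat.find_min hx (Finset.mem_range.1 hj))).const_mul _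
    have hsplit : ∀ y, (∑' j, (1 / 4 : ℝ) ^ j * u j y) =
        (∑ j ∈ Finset.range k, (1 / 4 : ℝ) ^ j * u j y) + ((1 / 4 : ℝ) ^ k * u k y +
          ∑' j, (1 / 4 : ℝ) ^ (j + (k + 1)) * u (j + (k + 1)) y) := by
      intro y
      rw [← (summable_geometric_mul fun j => hu j y).sum_add_tsum_nat_add (k + 1),
        Finset.sum_range_succ, add_assoc]
    have htail : ∀ y, 0 ≤ ∑' j, (1 / 4 : ℝ) ^ (j + (k + 1)) * u (j + (k + 1)) y ∧
        ∑' j, (1 / 4 : ℝ) ^ (j + (k + 1)) * u (j + (k + 1)) y ≤ (1 / 4 : ℝ) ^ k * (1 / 3) := by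
      intro y
      have hgeo : HasSum (fun j : ℕ => (1 / 4 : ℝ) ^ (j + (k + 1))) ((1 / 4 : ℝ) ^ k * (1 / 3)) := by
        have := (hasSum_geometric_of_lt_one (r := (1 / 4 : ℝ)) (by norm_num)
          (by norm_num)).mul_right ((1 / 4 : ℝ) ^ (k + 1))
        have h2 : (1 - 1 / 4 : ℝ)⁻¹ * (1 / 4) ^ (k + 1) = (1 / 4 : ℝ) ^ k * (1 / 3) := by
          rw [pow_succ]; ring
        simp only [← pow_add] at this
        rwa [h2] at this
      refine ⟨tsum_nonneg fun j => mul_nonneg (by positivity) (hu _ y).1, ?_⟩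
      rw [← hgeo.tsum_eq]
      refine Summable.tsum_le_tsum (fun j => mul_le_of_le_one_right (by positivity) (hu _ y).2)
        ?_ hgeo.summable
      exact (summable_nat_add_iff (k + 1)).2 (summable_geometric_mul fun j => hu j y)
    have hdiff := hcont.sub hhead
    have hpos : (0 : ℝ) < (1 / 4 : ℝ) ^ k := by positivity
    have hlt : ∀ᶠ y in 𝓝 x, (∑' j, (1 / 4 : ℝ) ^ j * u j y) -
        (∑ j ∈ Finset.range k, (1 / 4 : ℝ) ^ j * u j y) < (1 / 4 : ℝ) ^ k := by
      refine hdiff.eventually (gt_mem_nhds ?_)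
      rw [Pi.sub_apply, hsplit x, h0 k x hk]
      linarith [(htail x).2]
    obtain ⟨p, hp1, hp⟩ := ((h1 k x hk).and_eventually hlt).exists
    rw [hsplit p, hp1] at hp
    linarith [(htail p).1]

end Series

/-! ### Construction of the separately continuous function. -/

section Construction

variable {ι : Type*} {X : ι → Type*}

theorem projParallel_update [DecidableEq ι] (i : ι) (x : ∀ j, X j) (t : X i) :
    projParallel i (Function.update x i t) = projParallel i x :=
  funext fun j => Function.update_of_ne j.2 _ _

variable [∀ i, TopologicalSpace (X i)]

theorem projParallel_eq_snd_comp_piSplitAt [DecidableEq ι] (i : ι) :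
    (projParallel i : (∀ j, X j) → _) = Prod.snd ∘ Homeomorph.piSplitAt i X := rfl

theorem continuous_projParallel (i : ι) : Continuous (projParallel i : (∀ j, X j) → _) :=
  continuous_pi fun j => continuous_apply (j : ι)

theorem isOpenMap_projParallel (i : ι) : IsOpenMap (projParallel i : (∀ j, X j) → _) := by
  classical
  rw [projParallel_eq_snd_comp_piSplitAt]
  exact isOpenMap_snd.comp (Homeomorph.piSplitAt i X).isOpenMap

theorem IsMeagre.exists_isClosed_dense_compl {Z : Type*} [TopologicalSpace Z] {s : Set Z}
    (hs : IsMeagre s) :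
    ∃ N : ℕ → Set Z, (∀ m, IsClosed (N m) ∧ Dense (N m)ᶜ) ∧ s ⊆ ⋃ m, N m := by
  obtain ⟨T, hT, hTc, hsT⟩ := isMeagre_iff_countable_union_isNowhereDense.1 hs
  have hTc' : (insert ∅ T).Countable := hTc.insert _
  obtain ⟨g, hg⟩ := hTc'.exists_eq_range (insert_nonempty _ _)
  refine ⟨fun m => closure (g m), fun m => ⟨isClosed_closure, ?_⟩, fun x hx => ?_⟩
  · have : g m ∈ insert ∅ T := hg ▸ mem_range_self m
    rw [← interior_eq_empty_iff_dense_compl]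
    rcases this with h | h
    · simp [h]
    · exact hT _ h
  · obtain ⟨t, ht, hxt⟩ := hsT hx
    obtain ⟨m, hm⟩ : t ∈ range g := hg ▸ mem_insert_of_mem _ ht
    exact mem_iUnion.2 ⟨m, subset_closure (hm.symm ▸ hxt)⟩

/-- A projectively meagre `F_σ` set is a countable union of closed sets each of whose projections
lies in a closed nowhere dense set. -/
theorem ProjectivelyMeagre.exists_iUnion_eq [Finite ι] {E : Set (∀ i, X i)}
    (hE : ProjectivelyMeagre E)
    (hF : IsFSigma E) :
    ∃ (F : ℕ → Set (∀ i, X i)) (N : ∀ (_ : ℕ) (i : ι), Set (∀ j : {j // j ≠ i}, X j)),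
      (∀ k, IsClosed (F k)) ∧ (∀ k i, IsClosed (N k i) ∧ Dense (N k i)ᶜ) ∧
      (∀ k i, F k ⊆ projParallel i ⁻¹' N k i) ∧ E = ⋃ k, F k := by
  obtain ⟨C, hC, rfl⟩ := hF
  choose N hN hsub using fun i => (hE i).exists_isClosed_dense_compl
  obtain ⟨g, hg⟩ := exists_surjective_nat (ℕ × (ι → ℕ))
  -- An index codes one closed piece and, for each `i`, one nowhere dense set; finiteness of `ι`
  -- keeps these choices countable.
  refine ⟨fun k => C (g k).1 ∩ ⋂ i, projParallel i ⁻¹' N i ((g k).2 i),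
    fun k i => N i ((g k).2 i), fun k => (hC _).inter (isClosed_iInter fun i =>
      (hN i _).1.preimage (continuous_projParallel i)), fun k i => hN i _,
    fun k i x hx => mem_iInter.1 hx.2 i, ?_⟩
  refine Subset.antisymm (fun x hx => ?_) (iUnion_subset fun k =>
    inter_subset_left.trans (subset_iUnion C _))
  have : ∀ i, ∃ m, projParallel i x ∈ N i m := fun i =>
    mem_iUnion.1 (hsub i (mem_image_of_mem _ hx))
  choose m hm using this
  obtain ⟨c, hc⟩ := mem_iUnion.1 hx
  obtain ⟨k, hk⟩ := hg (c, m)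
  exact mem_iUnion.2 ⟨k, by rw [hk]; exact ⟨hc, mem_iInter.2 hm⟩⟩

/-- Every projectively meagre `F_σ` set in a finite product of separable metrizable spaces is the
discontinuity set of a separately continuous function. -/
theorem ProjectivelyMeagre.exists_separatelyContinuous [Finite ι] [DecidableEq ι] [Nonempty ι]
    [∀ i, T3Space (X i)] [∀ i, SecondCountableTopology (X i)] {E : Set (∀ i, X i)}
    (hE : ProjectivelyMeagre E) (hF : IsFSigma E) :
    ∃ f : (∀ i, X i) → ℝ, SeparatelyContinuous f ∧ discontinuityPoints f = E := by
  obtain ⟨F, N, hFc, hN, hFN, rfl⟩ := hE.exists_iUnion_eq hF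
  let : MetricSpace (∀ i, X i) := metrizableSpaceMetric _
  set K : ℕ → Set (∀ i, X i) := fun k => ⋃ i, projParallel i ⁻¹' N k i
  have hKc : ∀ k, IsClosed (K k) := fun k =>
    isClosed_iUnion_of_finite fun i => (hN k i).1.preimage (continuous_projParallel i)
  have hKd : ∀ k, Dense (K k)ᶜ := fun k => by
    rw [compl_iUnion]
    refine Set.Finite.dense_sInter (s := range fun i => (projParallel i ⁻¹' N k i)ᶜ)
      (finite_range _) ?_ ?_
    · rintro _ ⟨i, rfl⟩
      exact ((hN k i).1.preimage (continuous_projParallel i)).isOpen_compl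
    · rintro _ ⟨i, rfl⟩
      exact (hN k i).2.preimage (isOpenMap_projParallel i)
  have hFK : ∀ k, F k ⊆ K k := fun k x hx =>
    mem_iUnion.2 ⟨Classical.arbitrary ι, hFN k _ hx⟩
  choose u hu hu0 huc hu1 using fun k =>
    exists_vanishing_continuousAt_off (hFc k) (hKc k) (hKd k) (hFK k)
  have husep : ∀ k, SeparatelyContinuous (u k) := by
    intro k i x
    rw [continuous_iff_continuousAt]
    intro t
    have hupd : Continuous fun t => Function.update x i t := continuous_const.update i continuous_id
    by_cases hx : Function.update x i t ∈ F k
    -- The whole line through this point in direction `i` has the same projection, so it lies in `K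
    -- k`, where `u k` vanishes.
    · have hz : ∀ s, u k (Function.update x i s) = 0 := fun s => by
        refine hu0 k _ (mem_iUnion.2 ⟨i, ?_⟩)
        have := hFN k i hx
        rw [mem_preimage, projParallel_update] at this ⊢
        exact this
      simp only [hz]
      exact continuousAt_const
    · exact ContinuousAt.comp (f := fun t => Function.update x i t) (huc k _ hx)
        hupd.continuousAt
  refine ⟨fun x => ∑' k, (1 / 4 : ℝ) ^ k * u k x, fun i x => ?_,
    discontinuityPoints_tsum_geometric_mul hu (fun k x hx => hu0 k x (hFK k hx)) huc hu1⟩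
  rw [continuous_iff_continuousAt]
  exact fun t => tendsto_tsum_geometric_mul (fun k s => hu k _)
    fun k => (husep k i x).continuousAt

end Construction

/-! ### Sections of residual sets. -/

section KuratowskiUlam

/-- The Kuratowski–Ulam theorem: almost all sections of a residual set are residual. -/
theorem eventually_residual_section_mem {A B : Type*} [TopologicalSpace A] [TopologicalSpace B]
    [SecondCountableTopology B] {R : Set (A × B)} (hR : R ∈ residual (A × B)) :
    ∀ᶠ a in residual A, {b | (a, b) ∈ R} ∈ residual B := by
  obtain ⟨T, hTo, hTd, hTc, hTR⟩ := mem_residual_iff.1 hR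
  have key : ∀ t ∈ T, ∀ᶠ a in residual A, Dense {b | (a, b) ∈ t} := by
    intro t ht
    -- For each basic `U`, the section meets `U` for an open dense set of `a`; countably many such
    -- conditions give density of the section.
    have hU : ∀ U ∈ countableBasis B, ∀ᶠ a in residual A, ∃ b ∈ U, (a, b) ∈ t := by
      intro U hU
      have hUo := isOpen_of_mem_countableBasis hU
      refine residual_of_dense_open ?_ ?_
      · have : {a | ∃ b ∈ U, (a, b) ∈ t} = Prod.fst '' (t ∩ univ ×ˢ U) := by
          ext a
          simp [and_comm]
        rw [this]
        exact isOpenMap_fst _ ((hTo t ht).inter (isOpen_univ.prod hUo))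
      · refine dense_iff_inter_open.2 fun V hV hVne => ?_
        obtain ⟨⟨a, b⟩, hab, hmem⟩ := (hTd t ht).inter_open_nonempty (V ×ˢ U) (hV.prod hUo)
          (hVne.prod (nonempty_of_mem_countableBasis hU))
        exact ⟨a, hab.1, b, hab.2, hmem⟩
    filter_upwards [(eventually_countable_ball (countable_countableBasis B)).2 hU] with a ha
    refine (isBasis_countableBasis B).dense_iff.2 fun U hU _ => ?_
    obtain ⟨b, hb, hab⟩ := ha U hU
    exact ⟨b, hb, hab⟩
  filter_upwards [(eventually_countable_ball hTc).2 key] with a ha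
  have : ∀ t ∈ T, {b | (a, b) ∈ t} ∈ residual B := fun t ht =>
    residual_of_dense_open ((hTo t ht).preimage (Continuous.prodMk_right a)) (ha t ht)
  filter_upwards [(eventually_countable_ball hTc).2 this] with b hb
  exact hTR hb

end KuratowskiUlam

/-! ### Approximating values off a meagre set. -/

section QuasiContinuity

/-- The points without a meagre neighbourhood. -/
def locallyNonmeagrePoints (Z : Type*) [TopologicalSpace Z] : Set Z :=
  {z | ∀ U ∈ 𝓝 z, ¬ IsMeagre U}

/-- The complement is a union of countably many meagre basic open sets. Being open, it gains only a
nowhere dense frontier under closure. -/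
theorem isMeagre_closure_compl_locallyNonmeagrePoints (Z : Type*) [TopologicalSpace Z]
    [SecondCountableTopology Z] : IsMeagre (closure (locallyNonmeagrePoints Z)ᶜ) := by
  have hB : (locallyNonmeagrePoints Z)ᶜ = ⋃ U ∈ {U ∈ countableBasis Z | IsMeagre U}, U := by
    ext z
    simp only [locallyNonmeagrePoints, mem_compl_iff, mem_ofPred_eq, mem_iUnion]
    push Not
    constructor
    · rintro ⟨U, hU, hUm⟩
      obtain ⟨V, hV, hzV, hVU⟩ := (isBasis_countableBasis Z).mem_nhds_iff.1 hU
      exact ⟨V, ⟨hV, hUm.mono hVU⟩, hzV⟩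
    · rintro ⟨U, ⟨hU, hUm⟩, hzU⟩
      exact ⟨U, (isOpen_of_mem_countableBasis hU).mem_nhds hzU, hUm⟩
  have hopen : IsOpen (locallyNonmeagrePoints Z)ᶜ := by
    rw [hB]
    exact isOpen_biUnion fun U hU => isOpen_of_mem_countableBasis hU.1
  have hm : IsMeagre (locallyNonmeagrePoints Z)ᶜ := by
    rw [hB]
    exact isMeagre_biUnion ((countable_countableBasis Z).mono (sep_subset _ _)) fun U hU => hU.2
  rw [closure_eq_self_union_frontier]
  refine hm.union (IsNowhereDense.isMeagre ?_)
  rw [isClosed_frontier.isNowhereDense_iff, ← frontier_compl]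
  exact interior_frontier hopen.isClosed_compl

variable {ι : Type*} [DecidableEq ι] {X : ι → Type*} [∀ i, TopologicalSpace (X i)]

theorem piSplitAt_symm_projParallel (i : ι) (t : X i) (x : ∀ j, X j) :
    (Homeomorph.piSplitAt i X).symm (t, projParallel i x) = Function.update x i t := by
  refine (Homeomorph.symm_apply_eq _).2 (Prod.ext ?_ ?_)
  · simp [Homeomorph.piSplitAt, Equiv.piSplitAt]
  · exact (projParallel_update i x t).symm

theorem piSplitAt_symm_update (i : ι) (t : X i) (z : ∀ j : {j // j ≠ i}, X j) (j : {j // j ≠ i})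
    (s : X j) : (Homeomorph.piSplitAt i X).symm (t, Function.update z j s) =
      Function.update ((Homeomorph.piSplitAt i X).symm (t, z)) (j : ι) s := by
  ext l
  rcases eq_or_ne l j with rfl | hlj
  · simp [Homeomorph.piSplitAt, Equiv.piSplitAt, j.2]
  · rcases eq_or_ne l i with rfl | hli
    · simp [Homeomorph.piSplitAt, Equiv.piSplitAt, hlj]
    · have : (⟨l, hli⟩ : {j // j ≠ i}) ≠ j := fun h => hlj (congrArg Subtype.val h)
      simp [Homeomorph.piSplitAt, Equiv.piSplitAt, hlj, hli, this]

theorem SeparatelyContinuous.comp_piSplitAt_symm {Z : Type*} [TopologicalSpace Z]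
    {f : (∀ i, X i) → Z} (hf : SeparatelyContinuous f) (i : ι) (t : X i) :
    SeparatelyContinuous fun z => f ((Homeomorph.piSplitAt i X).symm (t, z)) := by
  intro j z
  simp only [piSplitAt_symm_update]
  exact hf j _

theorem SeparatelyContinuous.continuous_piSplitAt_symm_left {Z : Type*} [TopologicalSpace Z]
    {f : (∀ i, X i) → Z} (hf : SeparatelyContinuous f) (i : ι) (z : ∀ j : {j // j ≠ i}, X j) :
    Continuous fun t => f ((Homeomorph.piSplitAt i X).symm (t, z)) := by
  rcases isEmpty_or_nonempty (X i) with h | ⟨⟨t₀⟩⟩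
  · exact continuous_of_const fun a => h.elim a
  · have : z = projParallel i ((Homeomorph.piSplitAt i X).symm (t₀, z)) :=
      (congrArg Prod.snd ((Homeomorph.piSplitAt i X).apply_symm_apply (t₀, z))).symm
    rw [this]
    simp only [piSplitAt_symm_projParallel]
    exact hf i _

/-- At points whose coordinates have no meagre neighbourhoods, the values of a separately
continuous function are approximated by its values off a given meagre set. -/
theorem SeparatelyContinuous.exists_notMem_of_isMeagre (n : ℕ) :
    ∀ {ι : Type u} [Finite ι] [DecidableEq ι] {X : ι → Type v} [∀ i, TopologicalSpace (X i)]
    [∀ i, SecondCountableTopology (X i)] (_ : Nat.card ι = n) {f : (∀ i, X i) → ℝ}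
    (_ : SeparatelyContinuous f) {N : Set (∀ i, X i)} (_ : IsMeagre N) {x : ∀ i, X i}
    (_ : ∀ i, x i ∈ locallyNonmeagrePoints (X i)) {V : Set (∀ i, X i)} (_ : V ∈ 𝓝 x) {ε : ℝ}
    (_ : 0 < ε), ∃ y ∈ V, y ∉ N ∧ |f y - f x| < ε := by
  induction n using Nat.strong_induction_on with
  | _ n ih =>
  intro ι _ _ X _ _ hn f hf N hN x hx V hV ε hε
  rcases isEmpty_or_nonempty ι with hι | ⟨⟨i⟩⟩
  · refine ⟨x, mem_of_mem_nhds hV, fun hxN => ?_, by simpa using hε⟩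
    obtain ⟨y, hy⟩ := (dense_of_mem_residual (hN : Nᶜ ∈ residual _)).nonempty_iff.2 ⟨x⟩
    exact hy (Subsingleton.elim x y ▸ hxN)
  · set h := Homeomorph.piSplitAt i X
    have hhx : h.symm (x i, projParallel i x) = x := by
      rw [piSplitAt_symm_projParallel, Function.update_eq_self]
    have hN' : IsMeagre (h.symm ⁻¹' N) :=
      hN.preimage_of_isOpenMap h.symm.continuous h.symm.isOpenMap
    have hres := eventually_residual_section_mem (R := (h.symm ⁻¹' N)ᶜ) hN'
    have hV' : h.symm ⁻¹' V ∈ 𝓝 (x i, projParallel i x) :=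
      h.symm.continuous.continuousAt.preimage_mem_nhds (by rwa [hhx])
    obtain ⟨V₁, hV₁, V₂, hV₂, hsub⟩ := mem_nhds_prod_iff.1 hV'
    have hnear : ∀ᶠ t in 𝓝 (x i), |f (h.symm (t, projParallel i x)) - f x| < ε / 2 := by
      have := (hf.continuous_piSplitAt_symm_left i (projParallel i x)).continuousAt (x := x i)
      have := this.eventually (Metric.ball_mem_nhds _ (half_pos hε))
      simpa only [Metric.mem_ball, Real.dist_eq, hhx, h] using this
    -- This neighbourhood of `x i` is not meagre, so by Kuratowski–Ulam it contains some `t` whose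
    -- section of `N` is meagre; induction applies to that section.
    have hnm := hx i _ (inter_mem hV₁ hnear)
    obtain ⟨t, ⟨htV, htf⟩, htN⟩ : ∃ t,
        t ∈ V₁ ∩ {t | |f (h.symm (t, projParallel i x)) - f x| < ε / 2} ∧
        {z | (t, z) ∈ (h.symm ⁻¹' N)ᶜ} ∈ residual _ := by
      by_contra! hcon
      exact hnm (mem_of_superset hres fun t ht htm => hcon t htm ht)
    obtain ⟨z, hzV, hzN, hz⟩ := ih (Nat.card {j // j ≠ i})
      (hn ▸ Finite.card_subtype_lt (x := i) (by simp)) rfl (hf.comp_piSplitAt_symm i t)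
      (N := {z | h.symm (t, z) ∈ N}) htN (x := projParallel i x) (fun j => hx j) hV₂ (half_pos hε)
    refine ⟨h.symm (t, z), hsub ⟨htV, hzV⟩, hzN, ?_⟩
    have htf' : |f (h.symm (t, projParallel i x)) - f x| < ε / 2 := htf
    exact (abs_sub_le _ (f (h.symm (t, projParallel i x))) _).trans_lt (by linarith)

end QuasiContinuity

/-! ### Projective meagreness of the discontinuity set. -/

section Discontinuity

/-- `A U k` collects the `z` for which `F z` oscillates by at most `1 / (k + 1)` on `U`. Off the
meagre set `M` it is relatively closed, so outside the frontiers a small oscillation at `z` persists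
nearby off `M`. Hypothesis `hq` carries the estimate over to points of `M`. -/
theorem isMeagre_setOf_exists_not_continuousAt {Z Y : Type*} [TopologicalSpace Z]
    [TopologicalSpace Y] [SecondCountableTopology Y] {F : Z → Y → ℝ} {G : Set Z} (hG : IsOpen G)
    (hGm : IsMeagre Gᶜ) (hc : ∀ z, Continuous (F z))
    (hD : ∀ y, IsMeagre (discontinuityPoints fun z => F z y))
    (hq : ∀ y, ∀ z ∈ G, ∀ N, IsMeagre N → ∀ V ∈ 𝓝 z, ∀ ε > 0,
      ∃ z' ∈ V, z' ∉ N ∧ |F z' y - F z y| < ε) :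
    IsMeagre {z | ∃ y, ¬ ContinuousAt (fun p : Z × Y => F p.1 p.2) (z, y)} := by
  obtain ⟨d, hdc, hdd⟩ := exists_countable_dense Y
  set M : Set Z := ⋃ y ∈ d, discontinuityPoints fun z => F z y
  have hM : IsMeagre M := isMeagre_biUnion hdc fun y _ => hD y
  let A : Set Y → ℕ → Set Z := fun U k =>
    {z | ∀ y ∈ U, ∀ y' ∈ U, |F z y - F z y'| ≤ 1 / ((k : ℝ) + 1)}
  have hcl : ∀ U k, IsOpen U → ∀ z ∈ closure (A U k), z ∉ M → z ∈ A U k := by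
    intro U k hU z hz hzM
    have hcont : ∀ y ∈ d, ContinuousAt (fun z => F z y) z := fun y hy => by
      by_contra h
      exact hzM (mem_biUnion hy h)
    have h1 : ∀ y ∈ U ∩ d, ∀ y' ∈ U ∩ d, |F z y - F z y'| ≤ 1 / ((k : ℝ) + 1) := by
      intro y hy y' hy'
      have : (𝓝[A U k] z).NeBot := mem_closure_iff_nhdsWithin_neBot.1 hz
      have hlim := ((hcont y hy.2).sub (hcont y' hy'.2)).abs.tendsto.mono_left
        (nhdsWithin_le_nhds (s := A U k))
      exact le_of_tendsto hlim (eventually_mem_nhdsWithin.mono fun w hw => hw y hy.1 y' hy'.1)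
    have h2 : ∀ y ∈ U ∩ d, ∀ y' ∈ U, |F z y - F z y'| ≤ 1 / ((k : ℝ) + 1) := by
      intro y hy y' hy'
      have hcl : IsClosed {y' | |F z y - F z y'| ≤ 1 / ((k : ℝ) + 1)} :=
        isClosed_le (continuous_const.sub (hc z)).abs continuous_const
      exact closure_minimal (h1 y hy) hcl (hdd.open_subset_closure_inter hU hy')
    intro y hy y' hy'
    have hcl : IsClosed {y | |F z y - F z y'| ≤ 1 / ((k : ℝ) + 1)} :=
      isClosed_le ((hc z).sub continuous_const).abs continuous_const
    exact closure_minimal (fun y hy => h2 y hy y' hy') hcl (hdd.open_subset_closure_inter hU hy)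
  have hbad : IsMeagre (Gᶜ ∪ M ∪ ⋃ U ∈ countableBasis Y, ⋃ k, frontier (closure (A U k))) := by
    refine (hGm.union hM).union (isMeagre_biUnion (countable_countableBasis Y) fun U _ =>
      isMeagre_iUnion fun k => IsNowhereDense.isMeagre ?_)
    rw [isClosed_frontier.isNowhereDense_iff]
    exact interior_frontier isClosed_closure
  refine hbad.mono ?_
  rintro z ⟨y, hzy⟩
  by_contra hz
  simp only [mem_union, mem_compl_iff, not_or, not_not, mem_iUnion, not_exists] at hz
  obtain ⟨⟨hzG, hzM⟩, hfr⟩ := hz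
  refine hzy (Metric.tendsto_nhds.2 fun ε hε => ?_)
  obtain ⟨k, hk⟩ := exists_nat_one_div_lt (show 0 < ε / 8 by positivity)
  have hnear : ∀ᶠ y' in 𝓝 y, |F z y' - F z y| < 1 / ((k : ℝ) + 1) / 2 := by
    have := ((hc z).continuousAt (x := y)).eventually
      (Metric.ball_mem_nhds _ (half_pos (Nat.one_div_pos_of_nat (n := k))))
    simpa only [Metric.mem_ball, Real.dist_eq] using this
  obtain ⟨U, hU, hyU, hUsub⟩ := (isBasis_countableBasis Y).mem_nhds_iff.1 hnear
  have hUo := isOpen_of_mem_countableBasis hU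
  have hzA : z ∈ A U k := fun a ha b hb => by
    have h1 : |F z a - F z y| < 1 / ((k : ℝ) + 1) / 2 := hUsub ha
    have h2 : |F z b - F z y| < 1 / ((k : ℝ) + 1) / 2 := hUsub hb
    rw [abs_sub_comm] at h2
    exact (abs_sub_le _ (F z y) _).trans (by linarith)
  have hzint : z ∈ interior (closure (A U k)) := by
    by_contra h
    refine hfr U hU k ⟨?_, h⟩
    rw [closure_closure]
    exact subset_closure hzA
  obtain ⟨y₀, hy₀U, hy₀d⟩ := hdd.inter_open_nonempty U hUo ⟨y, hyU⟩
  have hcz : ContinuousAt (fun z => F z y₀) z := by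
    by_contra h
    exact hzM (mem_biUnion hy₀d h)
  have hnear₂ : ∀ᶠ w in 𝓝 z, |F w y₀ - F z y₀| < ε / 8 := by
    have := hcz.eventually (Metric.ball_mem_nhds _ (show 0 < ε / 8 by positivity))
    simpa only [Metric.mem_ball, Real.dist_eq] using this
  have hall : ∀ᶠ v in 𝓝 z, ∀ᶠ w in 𝓝 v, w ∈ G ∧ w ∈ interior (closure (A U k)) ∧
      |F w y₀ - F z y₀| < ε / 8 :=
    ((hG.eventually_mem hzG).and ((isOpen_interior.eventually_mem hzint).and
      hnear₂)).eventually_nhds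
  have hprod : ∀ᶠ p : Z × Y in 𝓝 (z, y), (∀ᶠ w in 𝓝 p.1, w ∈ G ∧
      w ∈ interior (closure (A U k)) ∧ |F w y₀ - F z y₀| < ε / 8) ∧ p.2 ∈ U := by
    rw [nhds_prod_eq]
    exact hall.prod_mk (hUo.mem_nhds hyU)
  filter_upwards [hprod] with p hp
  -- The chain `F p.1 p.2`, `F w p.2`, `F w y₀`, `F z y₀`, `F z y` has four steps, each at most `ε /
  -- 8`.
  obtain ⟨w, hw, hwM, hwF⟩ := hq p.2 p.1 hp.1.self_of_nhds.1 M hM _ hp.1 (ε / 8) (by positivity)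
  have hwA := hcl U k hUo w (interior_subset hw.2.1) hwM
  have e1 := abs_lt.1 hwF
  have e2 := abs_le.1 (hwA p.2 hp.2 y₀ hy₀U)
  have e3 := abs_lt.1 hw.2.2
  have e4 := abs_le.1 (hzA y₀ hy₀U y hyU)
  rw [Real.dist_eq, abs_lt]
  constructor <;> linarith [e1.1, e1.2, e2.1, e2.2, e3.1, e3.2, e4.1, e4.2]

/-- The discontinuity set of a separately continuous function of finitely many variables ranging
over second countable spaces is projectively meagre. -/
theorem SeparatelyContinuous.projectivelyMeagre_discontinuityPoints (n : ℕ) :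
    ∀ {ι : Type u} [Finite ι] [DecidableEq ι] {X : ι → Type v} [∀ i, TopologicalSpace (X i)]
    [∀ i, SecondCountableTopology (X i)] (_ : Nat.card ι = n) {f : (∀ i, X i) → ℝ}
    (_ : SeparatelyContinuous f), ProjectivelyMeagre (discontinuityPoints f) := by
  induction n using Nat.strong_induction_on with
  | _ n ih =>
  intro ι _ _ X _ _ hn f hf i
  set h := Homeomorph.piSplitAt i X
  let F : (∀ j : {j // j ≠ i}, X j) → X i → ℝ := fun z t => f (h.symm (t, z))
  let G : Set (∀ j : {j // j ≠ i}, X j) :=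
    ⋂ j, (fun z => z j) ⁻¹' (closure (locallyNonmeagrePoints (X j))ᶜ)ᶜ
  have hG : IsOpen G := isOpen_iInter_of_finite fun j =>
    isClosed_closure.isOpen_compl.preimage (continuous_apply j)
  have hGm : IsMeagre Gᶜ := by
    simp only [G, compl_iInter, ← preimage_compl, compl_compl]
    exact isMeagre_iUnion fun j =>
      (isMeagre_closure_compl_locallyNonmeagrePoints (X j)).preimage_of_isOpenMap
        (continuous_apply j) (isOpenMap_eval j)
  have hD : ∀ t, IsMeagre (discontinuityPoints fun z => F z t) := by
    intro t
    have hpm := ih (Nat.card {j // j ≠ i}) (hn ▸ Finite.card_subtype_lt (x := i) (by simp)) rfl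
      (hf.comp_piSplitAt_symm i t)
    -- With no other variable the section lives on a one-point space. Otherwise its discontinuity
    -- set lies in the preimage of a meagre projection under an open map.
    rcases isEmpty_or_nonempty {j // j ≠ i} with he | ⟨⟨j⟩⟩
    · have : discontinuityPoints (fun z => F z t) = ∅ :=
        eq_empty_of_forall_notMem fun z hz => hz continuous_of_discreteTopology.continuousAt
      rw [this]
      exact IsMeagre.empty
    · exact ((hpm j).preimage_of_isOpenMap (continuous_projParallel j)
        (isOpenMap_projParallel j)).mono (subset_preimage_image _ _)
  refine (isMeagre_setOf_exists_not_continuousAt (F := F) hG hGm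
    (fun z => hf.continuous_piSplitAt_symm_left i z) hD ?_).mono ?_
  · intro t z hz N hN V hV ε hε
    refine SeparatelyContinuous.exists_notMem_of_isMeagre _ rfl (hf.comp_piSplitAt_symm i t) hN
      (fun j => ?_) hV hε
    by_contra hj
    exact mem_iInter.1 hz j (subset_closure hj)
  · rintro _ ⟨x, hx, rfl⟩
    refine ⟨x i, fun hcont => hx ?_⟩
    have h1 : ContinuousAt (fun x : ∀ j, X j => (projParallel i x, x i)) x :=
      ((continuous_projParallel i).prodMk (continuous_apply i)).continuousAt
    have h2 := ContinuousAt.comp (f := fun x : ∀ j, X j => (projParallel i x, x i)) hcont h1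
    refine h2.congr (Eventually.of_forall fun y => ?_)
    simp only [Function.comp, F, h, piSplitAt_symm_projParallel, Function.update_eq_self]

end Discontinuity

/-! ### Passage between the full product and subproducts. -/

section RestrictProj

variable {ι : Type*} {S : ι → Type*} {X : ∀ i, S i → Type*}

/-- Extend a point of the product over the coordinates in `T i` by the coordinates of `x`. -/
noncomputable def extendBy (T : ∀ i, Set (S i)) (x : ∀ i s, X i s) (y : ∀ i, ∀ s : T i, X i s) :
    ∀ i s, X i s :=
  open Classical in
  fun i s => if h : s ∈ T i then y i ⟨s, h⟩ else x i s

theorem restrictProj_extendBy (T : ∀ i, Set (S i)) (x : ∀ i s, X i s)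
    (y : ∀ i, ∀ s : T i, X i s) : restrictProj T (extendBy T x y) = y := by
  ext i s
  simp [restrictProj, extendBy]

theorem extendBy_restrictProj (T : ∀ i, Set (S i)) (x : ∀ i s, X i s) :
    extendBy T x (restrictProj T x) = x := by
  ext i s
  simp [restrictProj, extendBy]

theorem restrictProj_update [DecidableEq ι] (T : ∀ i, Set (S i)) (x : ∀ i s, X i s) (i : ι)
    (t : ∀ s, X i s) : restrictProj T (Function.update x i t) =
      Function.update (restrictProj T x) i fun s => t s := by
  ext j s
  rcases eq_or_ne j i with rfl | hji
  · simp [restrictProj]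
  · simp [restrictProj, hji]

theorem extendBy_update [DecidableEq ι] (T : ∀ i, Set (S i)) (x : ∀ i s, X i s)
    (y : ∀ i, ∀ s : T i, X i s) (i : ι) (t : ∀ s : T i, X i s) :
    extendBy T x (Function.update y i t) = Function.update (extendBy T x y) i
      (extendBy T x (Function.update y i t) i) := by
  ext j s
  rcases eq_or_ne j i with rfl | hji
  · simp
  · simp [extendBy, hji]

variable [∀ i s, TopologicalSpace (X i s)]

theorem continuous_restrictProj (T : ∀ i, Set (S i)) :
    Continuous (restrictProj T : (∀ i s, X i s) → _) := by
  unfold restrictProj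
  fun_prop

theorem continuous_extendBy (T : ∀ i, Set (S i)) (x : ∀ i s, X i s) :
    Continuous (extendBy T x) := by
  refine continuous_pi fun i => continuous_pi fun s => ?_
  by_cases h : s ∈ T i
  · simp only [extendBy, dif_pos h]
    fun_prop
  · simp only [extendBy, dif_neg h]
    fun_prop

/-- `extendBy T x` is a continuous section of the projection passing through `x` itself, so
continuity of the composite at `x` descends to `g`. -/
theorem discontinuityPoints_comp_restrictProj {Z : Type*} [TopologicalSpace Z]
    (T : ∀ i, Set (S i)) (g : (∀ i, ∀ s : T i, X i s) → Z) :
    discontinuityPoints (fun x => g (restrictProj T x)) =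
      restrictProj T ⁻¹' discontinuityPoints g := by
  ext x
  refine not_congr ⟨fun h => ?_, fun h => ?_⟩
  · rw [← extendBy_restrictProj T x] at h
    have := ContinuousAt.comp (f := extendBy T x) h (continuous_extendBy T x).continuousAt
    simpa only [Function.comp_def, restrictProj_extendBy] using this
  · exact ContinuousAt.comp (f := restrictProj T) h (continuous_restrictProj T).continuousAt

variable [DecidableEq ι]

theorem SeparatelyContinuous.comp_restrictProj {Z : Type*} [TopologicalSpace Z]
    {T : ∀ i, Set (S i)} {g : (∀ i, ∀ s : T i, X i s) → Z} (hg : SeparatelyContinuous g) :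
    SeparatelyContinuous fun x => g (restrictProj T x) := by
  intro i x
  simp only [restrictProj_update]
  exact (hg i _).comp (by fun_prop)

theorem SeparatelyContinuous.comp_extendBy {Z : Type*} [TopologicalSpace Z]
    (T : ∀ i, Set (S i)) (x : ∀ i s, X i s) {f : (∀ i s, X i s) → Z}
    (hf : SeparatelyContinuous f) : SeparatelyContinuous fun y => f (extendBy T x y) := by
  intro i y
  rw [funext fun t => congrArg f (extendBy_update T x y i t)]
  exact (hf i _).comp ((continuous_apply i).comp ((continuous_extendBy T x).comp
    (continuous_const.update i continuous_id)))

end RestrictProj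

theorem isFSigma_discontinuityPoints {Y : Type*} [TopologicalSpace Y] (f : Y → ℝ) :
    IsFSigma (discontinuityPoints f) := by
  obtain ⟨U, hU, hUeq⟩ := (IsGδ.setOfPred_continuousAt f).eq_iInter_nat
  refine ⟨fun k => (U k)ᶜ, fun k => (hU k).isClosed_compl, ?_⟩
  rw [← compl_iInter, ← hUeq]
  rfl

theorem mainTheorem1 {n : ℕ} (hn : 1 ≤ n) {S : Fin n → Type*}
    {X : ∀ i : Fin n, S i → Type*} [∀ i s, TopologicalSpace (X i s)]
    [∀ i s, TopologicalSpace.MetrizableSpace (X i s)]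
    [∀ i s, TopologicalSpace.SeparableSpace (X i s)]
    (E : Set (∀ i : Fin n, ∀ s : S i, X i s)) :
    (∃ f : (∀ i : Fin n, ∀ s : S i, X i s) → ℝ,
        SeparatelyContinuous f ∧ discontinuityPoints f = E) ↔
      ∃ T : ∀ i : Fin n, Set (S i), (∀ i, (T i).Countable) ∧
        ∃ E₀ : Set (∀ i : Fin n, ∀ s : T i, X i s),
          ProjectivelyMeagre E₀ ∧ IsFSigma E₀ ∧ E = restrictProj T ⁻¹' E₀ := by
  have : Nonempty (Fin n) := ⟨⟨0, hn⟩⟩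
  have hsc : ∀ i s, SecondCountableTopology (X i s) := fun i s => by
    let := metrizableSpaceMetric (X i s)
    exact UniformSpace.secondCountable_of_separable _
  constructor
  · rintro ⟨f, hf, rfl⟩
    -- An empty product has no base point `x₀` to fill in the discarded coordinates.
    rcases isEmpty_or_nonempty (∀ i s, X i s) with hX | ⟨⟨x₀⟩⟩
    · exact ⟨fun _ => ∅, fun _ => countable_empty, ∅, fun i => by
        rw [image_empty]
        exact IsMeagre.empty,
        ⟨fun _ => ∅, fun _ => isClosed_empty, by simp⟩, Subsingleton.elim _ _⟩
    set T := essentialCoords f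
    have hT : ∀ i, (T i).Countable := hf.countable_essentialCoords
    have : ∀ i, Countable (T i) := fun i => (hT i).to_subtype
    have hg := hf.comp_extendBy T x₀
    have hfg : f = fun x => f (extendBy T x₀ (restrictProj T x)) := by
      ext x
      refine hf.eq_of_eqOn_essentialCoords fun i s hs => ?_
      simp only [extendBy, restrictProj]
      rw [dif_pos hs]
    refine ⟨T, hT, discontinuityPoints fun y => f (extendBy T x₀ y),
      hg.projectivelyMeagre_discontinuityPoints _ rfl, isFSigma_discontinuityPoints _, ?_⟩
    conv_lhs => rw [hfg]
    exact discontinuityPoints_comp_restrictProj T fun y => f (extendBy T x₀ y)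
  · rintro ⟨T, hT, E₀, hm, hF, rfl⟩
    have : ∀ i, Countable (T i) := fun i => (hT i).to_subtype
    obtain ⟨g, hg, rfl⟩ := hm.exists_separatelyContinuous hF
    exact ⟨_, hg.comp_restrictProj, discontinuityPoints_comp_restrictProj T g⟩
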